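/- Let $k,d,\ell$ be positive integers with $d>k$ and $\ell\le\lfloor (d-1)/(k-1)\rfloor$ (for $k=1$ the latter is read as no condition on $\ell$), and let $M_1,\dots,M_\ell$ be real symmetric positive-definite $d\times d$ matrices. For a real symmetric matrix $M$ let $\lambda_1(M)$ denote its largest eigenvalue. Then there exists a real $d\times d$ matrix $A$ such that, for every $1\le i\le\ell$, $\mathrm{Tr}(A^TM_iA)>0$ and $$\frac{\lambda_1(A^TM_iA)}{\mathrm{Tr}(A^TM_iA)}<\frac1k .$$ -/

import Mathlib

open Matrix

/-- `lambdaOne M` is the largest (real) eigenvalue of the square real matrix `M`. -/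
noncomputable def lambdaOne {d : ℕ} (M : Matrix (Fin d) (Fin d) ℝ) : ℝ :=
  sSup {μ : ℝ | Module.End.HasEigenvalue (Matrix.toLin' M) μ}

/-- For a symmetric matrix of positive size, the first entry of the decreasing list of eigenvalues
(counted with multiplicity) is the maximum of the set in the definition of `lambdaOne`. -/
theorem isGreatest_eigenvalues₀ {d : ℕ} {M : Matrix (Fin d) (Fin d) ℝ} (hM : M.IsHermitian)
    (hd : 0 < Fintype.card (Fin d)) :
    IsGreatest {μ : ℝ | Module.End.HasEigenvalue (Matrix.toLin' M) μ}
      (hM.eigenvalues₀ ⟨0, hd⟩) := by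
  have key : {μ : ℝ | Module.End.HasEigenvalue (Matrix.toLin' M) μ}
      = Set.range hM.eigenvalues := by
    rw [← hM.spectrum_real_eq_range_eigenvalues, ← Matrix.spectrum_toLin']
    ext μ
    exact Module.End.hasEigenvalue_iff_mem_spectrum
  rw [key]
  constructor
  · refine ⟨(Fintype.equivOfCardEq (Fintype.card_fin _)) ⟨0, hd⟩, ?_⟩
    simp [Matrix.IsHermitian.eigenvalues]
  · rintro _ ⟨i, rfl⟩
    exact hM.eigenvalues₀_antitone (Fin.mk_le_of_le_val (Nat.zero_le _))

/-- For a symmetric matrix of positive size, `lambdaOne` is the first eigenvalue in decreasing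
order. -/
theorem lambdaOne_eq_eigenvalues₀ {d : ℕ} {M : Matrix (Fin d) (Fin d) ℝ} (hM : M.IsHermitian)
    (hd : 0 < Fintype.card (Fin d)) : lambdaOne M = hM.eigenvalues₀ ⟨0, hd⟩ :=
  (isGreatest_eigenvalues₀ hM hd).csSup_eq

/-!
Write `M i = (C i)ᵀ * C i` with `C i` invertible and look for `S = A * Aᵀ`. For fixed `i` the nonzero
eigenvalues of `Aᵀ * M i * A` are those of `C i * S * (C i)ᵀ`, so what is wanted is
`vᵀ (C i * S * (C i)ᵀ) v < tr (C i * S * (C i)ᵀ) / k` for all unit vectors `v`, that is, `S` must pair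
negatively (through the trace) with every matrix `(C i)ᵀ * (v vᵀ - 1 / k) * C i`. This is a system of
linear inequalities in the positive semidefinite matrix `S`.

By Hahn-Banach (`exists_posSemidef_trace_mul_neg`) such an `S` exists as soon as the convex hull of
these matrices, `∑ i, (C i)ᵀ * (R i - (tr (R i) / k) • 1) * C i` with `R i` positive semidefinite of
total trace one, contains no positive semidefinite matrix. That is `not_posSemidef_sum_traceDefect`:
at most `k - 1` eigenvalues of `R i` can exceed the fraction `1 / k` of its trace. As
`ℓ * (k - 1) < d`, some `x ≠ 0` has each `C i *ᵥ x` orthogonal to the corresponding eigenvectors, and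
there all summands are nonpositive. The case of equality is settled by an alternative
(`Matrix.PosSemidef.exists_few_directions`): either the eigenvalues avoided include all those equal to
`tr (R i) / k`, and the summand is strictly negative at `x`, or `R i` has no eigenvalue above
`tr (R i) / k` at all. A positive semidefinite sum leaves only the second case for every `i`, and then
`R i = (tr (R i) / k) • 1` for all `i`; taking traces gives `k = d`, which is excluded.
-/

/-! ### Real positive semidefinite matrices -/

theorem convex_posSemidef {n : Type*} : Convex ℝ {S : Matrix n n ℝ | S.PosSemidef} :=
  fun _ hS _ hT _ _ ha hb _ => (hS.smul ha).add (hT.smul hb)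

variable {n : Type*} [Fintype n]

theorem posSemidef_real_iff {S : Matrix n n ℝ} :
    S.PosSemidef ↔ Sᵀ = S ∧ ∀ x, 0 ≤ x ⬝ᵥ S *ᵥ x := by
  simp [posSemidef_iff_dotProduct_mulVec, IsHermitian]

theorem isClosed_posSemidef : IsClosed {S : Matrix n n ℝ | S.PosSemidef} := by
  simp only [posSemidef_real_iff, Set.ofPred_and, Set.ofPred_forall]
  exact (isClosed_eq (by fun_prop) continuous_id).inter
    (isClosed_iInter fun x => isClosed_le continuous_const (by fun_prop))

theorem Matrix.PosSemidef.exists_eq_transpose_mul {S : Matrix n n ℝ} (hS : S.PosSemidef) :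
    ∃ B : Matrix n n ℝ, S = Bᵀ * B := by
  classical
  open scoped MatrixOrder in
  obtain ⟨B, hB⟩ := CStarAlgebra.nonneg_iff_eq_star_mul_self.1 (nonneg_iff_posSemidef.2 hS)
  exact ⟨B, by simpa [star_eq_conjTranspose] using hB⟩

theorem Matrix.PosSemidef.abs_apply_le_trace {S : Matrix n n ℝ} (hS : S.PosSemidef) (a b : n) :
    |S a b| ≤ S.trace := by
  obtain ⟨B, rfl⟩ := hS.exists_eq_transpose_mul
  have hd : ∀ a, (Bᵀ * B) a a ≤ (Bᵀ * B).trace := fun a =>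
    Finset.single_le_sum (f := fun a => (Bᵀ * B) a a) (fun _ _ => hS.diag_nonneg) (Finset.mem_univ a)
  have h : 2 * |(Bᵀ * B) a b| ≤ (Bᵀ * B) a a + (Bᵀ * B) b b := by
    simp only [mul_apply, transpose_apply]
    rw [← Finset.sum_add_distrib]
    refine (mul_le_mul_of_nonneg_left (Finset.abs_sum_le_sum_abs _ _) zero_le_two).trans ?_
    rw [Finset.mul_sum]
    refine Finset.sum_le_sum fun c _ => ?_
    rw [abs_mul]
    nlinarith [sq_nonneg (|B c a| - |B c b|), abs_mul_abs_self (B c a), abs_mul_abs_self (B c b)]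
  linarith [hd a, hd b]

/-! ### Tuples of positive semidefinite matrices with total trace one -/

/-- Tuples of positive semidefinite matrices of total trace one. A tuple `R` encodes a convex
combination with weights `(R i).trace` of density matrices `R i / (R i).trace`; leaving the weights
implicit makes the set convex and avoids a division by a vanishing weight. -/
def densityTuples (ι n : Type*) [Fintype ι] [Fintype n] : Set (ι → Matrix n n ℝ) :=
  {R | (∀ i, (R i).PosSemidef) ∧ ∑ i, (R i).trace = 1}

theorem convex_densityTuples {ι : Type*} [Fintype ι] : Convex ℝ (densityTuples ι n) := by
  rintro R ⟨hR, hRt⟩ T ⟨hT, hTt⟩ a b ha hb hab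
  refine ⟨fun i => convex_posSemidef (hR i) (hT i) ha hb hab, ?_⟩
  simp [Finset.sum_add_distrib, ← Finset.mul_sum, hRt, hTt, hab]

theorem isCompact_densityTuples {ι : Type*} [Fintype ι] : IsCompact (densityTuples ι n) := by
  have hK : IsCompact (Set.univ.pi fun _ : ι => Set.univ.pi fun _ : n => Set.univ.pi fun _ : n =>
      Set.Icc (-1 : ℝ) 1) :=
    isCompact_univ_pi fun _ => isCompact_univ_pi fun _ => isCompact_univ_pi fun _ => isCompact_Icc
  have hcont : Continuous fun R : ι → Matrix n n ℝ => ∑ i, (R i).trace :=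
    continuous_finsetSum _ fun i _ => Continuous.matrix_trace (continuous_apply i)
  have hcl : IsClosed (densityTuples ι n) := by
    simp only [densityTuples, Set.ofPred_and, Set.ofPred_forall]
    exact (isClosed_iInter fun i => isClosed_posSemidef.preimage (continuous_apply i)).inter
      (isClosed_eq hcont continuous_const)
  refine hK.of_isClosed_subset hcl ?_
  rintro (R : ι → Matrix n n ℝ) ⟨hR, htr⟩ i - a - b -
  have h1 := (hR i).abs_apply_le_trace a b
  have h2 := Finset.single_le_sum (f := fun i => (R i).trace) (fun i _ => (hR i).trace_nonneg)
    (Finset.mem_univ i)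
  exact abs_le.1 (h1.trans (h2.trans htr.le))

/-! ### Counting eigenvalues that exceed a fraction of the trace -/

theorem exists_ne_zero_common_kernel {ι : Type*} [Fintype ι] (W : ι → Matrix n n ℝ)
    (J : ι → Finset n) (h : ∑ i, (J i).card < Fintype.card n) :
    ∃ x : n → ℝ, x ≠ 0 ∧ ∀ i, ∀ j ∈ J i, (W i *ᵥ x) j = 0 := by
  let f : (n → ℝ) →ₗ[ℝ] ((Σ i, J i) → ℝ) :=
    LinearMap.pi fun p => LinearMap.proj p.2.1 ∘ₗ (W p.1).mulVecLin
  have hf : LinearMap.ker f ≠ ⊥ := f.ker_ne_bot_of_finrank_lt (by simpa using h)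
  obtain ⟨x, hx, hx0⟩ := Submodule.exists_mem_ne_zero_of_ne_bot hf
  exact ⟨x, hx0, fun i j hj => congrFun (LinearMap.mem_ker.1 hx) ⟨i, j, hj⟩⟩

theorem quadForm_conj (C R : Matrix n n ℝ) (x : n → ℝ) :
    x ⬝ᵥ (Cᵀ * R * C) *ᵥ x = (C *ᵥ x) ⬝ᵥ R *ᵥ (C *ᵥ x) := by
  rw [← mulVec_mulVec, ← mulVec_mulVec, dotProduct_mulVec, ← mulVec_transpose, transpose_transpose]

variable [DecidableEq n]

theorem quadForm_conj_diagonal (U : Matrix n n ℝ) (D : n → ℝ) (z : n → ℝ) :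
    z ⬝ᵥ (U * diagonal D * Uᵀ) *ᵥ z = ∑ j, D j * (Uᵀ *ᵥ z) j ^ 2 := by
  rw [← mulVec_mulVec, ← mulVec_mulVec, dotProduct_mulVec, ← mulVec_transpose]
  simp only [dotProduct, mulVec_diagonal]
  exact Finset.sum_congr rfl fun j _ => by ring

/-- Fewer than `k` eigenvalues of `R` are at least `tr R / k`, unless all of them are at most
`tr R / k`. Hence, off fewer than `k` eigendirections (the rows of `V` with index in `J`), the form of
`R` is strictly below `tr R / k`, or else it is at most `tr R / k` everywhere. -/
theorem Matrix.PosSemidef.exists_few_directions {R : Matrix n n ℝ} (hR : R.PosSemidef) {k : ℕ}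
    (hk : 0 < k) :
    ∃ (J : Finset n) (V : Matrix n n ℝ), J.card < k ∧
      ((∀ z, z ≠ 0 → (∀ j ∈ J, (V *ᵥ z) j = 0) → z ⬝ᵥ R *ᵥ z < R.trace / k * (z ⬝ᵥ z)) ∨
        ∀ z, z ⬝ᵥ R *ᵥ z ≤ R.trace / k * (z ⬝ᵥ z)) := by
  have hk' : (0 : ℝ) < k := by exact_mod_cast hk
  obtain ⟨U, D, hU, hRU, hD, htr⟩ : ∃ (U : Matrix n n ℝ) (D : n → ℝ), U * Uᵀ = 1 ∧
      R = U * diagonal D * Uᵀ ∧ (∀ j, 0 ≤ D j) ∧ R.trace = ∑ j, D j := by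
    refine ⟨hR.1.eigenvectorUnitary, hR.1.eigenvalues, ?_, ?_, hR.eigenvalues_nonneg, ?_⟩
    · simpa [star_eq_conjTranspose] using Unitary.mul_star_self_of_mem hR.1.eigenvectorUnitary.2
    · simpa [Unitary.conjStarAlgAut_apply, star_eq_conjTranspose, Function.comp_def]
        using hR.1.spectral_theorem
    · simpa using hR.1.trace_eq_sum_eigenvalues
  have hq : ∀ z, z ⬝ᵥ R *ᵥ z = ∑ j, D j * (Uᵀ *ᵥ z) j ^ 2 := fun z => by
    rw [hRU, quadForm_conj_diagonal]
  have hn : ∀ z, z ⬝ᵥ z = ∑ j, (Uᵀ *ᵥ z) j ^ 2 := fun z => by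
    have := quadForm_conj_diagonal U 1 z
    simpa [hU] using this
  by_cases hle : ∀ j, D j ≤ R.trace / k
  · refine ⟨∅, 1, by simpa using hk, Or.inr fun z => ?_⟩
    rw [hq, hn, Finset.mul_sum]
    exact Finset.sum_le_sum fun j _ => mul_le_mul_of_nonneg_right (hle j) (sq_nonneg _)
  push Not at hle
  obtain ⟨j₀, hj₀⟩ := hle
  refine ⟨Finset.univ.filter fun j => R.trace / k ≤ D j, Uᵀ, ?_, Or.inl fun z hz hJ => ?_⟩
  · have hpos : 0 < R.trace := by
      have h0 : 0 ≤ R.trace / k := div_nonneg hR.trace_nonneg hk'.le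
      have := Finset.single_le_sum (fun j _ => hD j) (Finset.mem_univ j₀)
      rw [htr] at *
      linarith
    -- the indices in `J` carry trace more than `#J * (tr R / k)`, because `j₀` is one of them
    have h1 : ∑ _j ∈ Finset.univ.filter (fun j => R.trace / k ≤ D j), R.trace / k < R.trace := by
      calc _ < ∑ j ∈ Finset.univ.filter (fun j => R.trace / k ≤ D j), D j :=
            Finset.sum_lt_sum (fun j hj => (Finset.mem_filter.1 hj).2)
              ⟨j₀, by simp [hj₀.le], hj₀⟩
        _ ≤ ∑ j, D j := Finset.sum_le_univ_sum_of_nonneg hD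
        _ = R.trace := htr.symm
    rw [Finset.sum_const, nsmul_eq_mul, mul_div_assoc', div_lt_iff₀ hk', mul_comm] at h1
    exact_mod_cast lt_of_mul_lt_mul_left h1 hpos.le
  · have hz' : ∃ j, (Uᵀ *ᵥ z) j ≠ 0 := by
      by_contra! h
      exact hz (dotProduct_self_eq_zero.1 (by simp [hn, h]))
    obtain ⟨j₁, hj₁⟩ := hz'
    rw [hq, hn, Finset.mul_sum]
    have key : ∀ j, (Uᵀ *ᵥ z) j ≠ 0 → D j < R.trace / k := fun j hj => by
      by_contra! h
      exact hj (hJ j (by simpa using h))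
    refine Finset.sum_lt_sum (fun j _ => ?_) ⟨j₁, Finset.mem_univ _, ?_⟩
    · by_cases hj : (Uᵀ *ᵥ z) j = 0
      · simp [hj]
      · exact mul_le_mul_of_nonneg_right (key j hj).le (sq_nonneg _)
    · exact mul_lt_mul_of_pos_right (key j₁ hj₁) (by positivity)

/-- `R - (tr R / k) • 1`, which is linear in `R`. For `k > 0` its quadratic form is negative
semidefinite exactly when no eigenvalue of the symmetric matrix `R` exceeds the fraction `1 / k` of
the trace. -/
noncomputable def traceDefect (k : ℕ) (R : Matrix n n ℝ) : Matrix n n ℝ :=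
  R - (R.trace / k) • 1

/-- The dual side of the argument. By the dimension count a nonzero `x` exists such that every
`C i *ᵥ x` avoids the large eigendirections of `R i`, so each summand is nonpositive at `x`. If the
sum were positive semidefinite, no summand could be strictly negative at `x`, so each
`traceDefect k (R i)` would be negative semidefinite, hence zero as a form, which forces
`tr (R i) = card n * tr (R i) / k` for all `i`, and so `card n = k` because the traces sum to one. -/
theorem not_posSemidef_sum_traceDefect {ι : Type*} [Fintype ι] {k : ℕ} (hk : 0 < k)
    (hkn : k < Fintype.card n) (hι : Fintype.card ι * (k - 1) < Fintype.card n)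
    (C : ι → Matrix n n ℝ) (hC : ∀ i, IsUnit (C i)) (R : ι → Matrix n n ℝ)
    (hR : ∀ i, (R i).PosSemidef) (htr : ∑ i, (R i).trace = 1) :
    ¬ (∑ i, (C i)ᵀ * traceDefect k (R i) * C i).PosSemidef := by
  intro hS
  have hsum : ∀ x, 0 ≤ ∑ i, (C i *ᵥ x) ⬝ᵥ traceDefect k (R i) *ᵥ (C i *ᵥ x) := fun x => by
    simpa [sum_mulVec, dotProduct_sum, quadForm_conj] using hS.dotProduct_mulVec_nonneg x
  have hdef : ∀ i z, z ⬝ᵥ traceDefect k (R i) *ᵥ z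
      = z ⬝ᵥ R i *ᵥ z - (R i).trace / k * (z ⬝ᵥ z) := fun i z => by
    simp [traceDefect, sub_mulVec, smul_mulVec]
  have hinj : ∀ i x, x ≠ 0 → C i *ᵥ x ≠ 0 := fun i x hx h =>
    hx (mulVec_injective_of_isUnit (hC i) (by simpa using h))
  choose J V hJ hV using fun i => (hR i).exists_few_directions hk
  obtain ⟨x, hx0, hx⟩ := exists_ne_zero_common_kernel (fun i => V i * C i) J <|
    (Finset.sum_le_card_nsmul _ _ (k - 1) fun i _ => Nat.le_sub_one_of_lt (hJ i)).trans_lt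
      (by simpa using hι)
  have hle : ∀ i, (C i *ᵥ x) ⬝ᵥ traceDefect k (R i) *ᵥ (C i *ᵥ x) ≤ 0 := fun i => by
    rw [hdef, sub_nonpos]
    rcases hV i with h | h
    · exact (h _ (hinj i x hx0) fun j hj => by simpa using hx i j hj).le
    · exact h _
  have hall : ∀ i z, z ⬝ᵥ traceDefect k (R i) *ᵥ z ≤ 0 := by
    intro i z
    rcases hV i with h | h
    · exfalso
      refine (hsum x).not_gt (Finset.sum_neg' (fun i _ => hle i) ⟨i, Finset.mem_univ i, ?_⟩)
      rw [hdef, sub_neg]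
      exact h _ (hinj i x hx0) fun j hj => by simpa using hx i j hj
    · rw [hdef, sub_nonpos]
      exact h z
  have hzero : ∀ i z, z ⬝ᵥ traceDefect k (R i) *ᵥ z = 0 := by
    intro i z
    obtain ⟨y, rfl⟩ := mulVec_surjective_iff_isUnit.2 (hC i) z
    refine le_antisymm (hall _ _) ?_
    by_contra! h
    exact (hsum y).not_gt (Finset.sum_neg' (fun i _ => hall i _) ⟨i, Finset.mem_univ i, h⟩)
  have htr0 : ∀ i, (R i).trace = Fintype.card n * ((R i).trace / k) := fun i => by
    have : ∀ j, R i j j = (R i).trace / k := fun j => by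
      have := hzero i (Pi.single j 1)
      rw [hdef] at this
      simpa [sub_eq_zero] using this
    conv_lhs => rw [trace]
    simp [this]
  have h1 := Finset.sum_congr (rfl : Finset.univ = Finset.univ) fun i _ => htr0 i
  rw [← Finset.mul_sum, ← Finset.sum_div, htr, mul_one_div,
    eq_div_iff (by exact_mod_cast hk.ne'), one_mul] at h1
  exact hkn.ne (by exact_mod_cast h1)

/-! ### Separation from the positive semidefinite cone -/

/-- Local convexity is inherited from the function type `n → n → ℝ` that `Matrix` unfolds to. -/
instance locallyConvexSpace_matrix : LocallyConvexSpace ℝ (Matrix n n ℝ) :=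
  inferInstanceAs (LocallyConvexSpace ℝ (n → n → ℝ))

/-- A linear functional on matrices is, on symmetric matrices, the trace pairing with a symmetric
matrix. -/
theorem exists_trace_representation (f : Matrix n n ℝ →ₗ[ℝ] ℝ) :
    ∃ S : Matrix n n ℝ, Sᵀ = S ∧ ∀ X, Xᵀ = X → f X = (S * X).trace := by
  let F : Matrix n n ℝ := of fun a b => f (single a b 1)
  have hF : ∀ X, f X = (Fᵀ * X).trace := fun X => by
    conv_lhs => rw [matrix_eq_sum_single X]
    have : ∀ a b, f (single a b (X a b)) = X a b * F a b := fun a b => by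
      rw [← mul_one (X a b), ← smul_eq_mul, ← smul_single, map_smul]
      simp [F]
    simp only [map_sum, this, trace, diag_apply, mul_apply, transpose_apply]
    rw [Finset.sum_comm]
    exact Finset.sum_congr rfl fun _ _ => Finset.sum_congr rfl fun _ _ => mul_comm _ _
  refine ⟨(1 / 2 : ℝ) • (F + Fᵀ), by simp [add_comm], fun X hX => ?_⟩
  have h1 : (F * X).trace = f X := by
    rw [hF, ← trace_transpose (F * X), transpose_mul, hX, trace_mul_comm]
  rw [smul_mul, add_mul, trace_smul, trace_add, h1, ← hF, smul_eq_mul]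
  ring

/-- Separation of a compact convex set from the cone of positive semidefinite matrices: since the
cone is self-dual for the trace pairing, the separating functional is itself given by a positive
semidefinite matrix. -/
theorem exists_posSemidef_trace_mul_neg {K : Set (Matrix n n ℝ)} (hK : IsCompact K)
    (hKc : Convex ℝ K) (hsymm : ∀ X ∈ K, Xᵀ = X) (hdisj : ∀ X ∈ K, ¬ X.PosSemidef) :
    ∃ S : Matrix n n ℝ, S.PosSemidef ∧ ∀ X ∈ K, (S * X).trace < 0 := by
  obtain ⟨f, u, v, hu, huv, hv⟩ := geometric_hahn_banach_compact_closed hKc hK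
    convex_posSemidef isClosed_posSemidef (Set.disjoint_left.2 hdisj)
  have hv0 : v < 0 := by simpa using hv 0 PosSemidef.zero
  have hpos : ∀ X : Matrix n n ℝ, X.PosSemidef → 0 ≤ f X := by
    intro X hX
    by_contra! h
    -- otherwise `f` would take the value `v` on the ray spanned by `X`
    have := hv ((v / f X) • X) (hX.smul (div_nonneg_of_nonpos hv0.le h.le))
    rw [map_smul, smul_eq_mul, div_mul_cancel₀ _ h.ne] at this
    exact this.false
  obtain ⟨S, hS, hfS⟩ := exists_trace_representation (f : Matrix n n ℝ →ₗ[ℝ] ℝ)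
  refine ⟨S, posSemidef_real_iff.2 ⟨hS, fun x => ?_⟩, fun X hX => ?_⟩
  · have hx : (vecMulVec x x).PosSemidef := by simpa using posSemidef_vecMulVec_self_star x
    have := hpos _ hx
    rwa [← ContinuousLinearMap.coe_coe, hfS _ (posSemidef_real_iff.1 hx).1, mul_vecMulVec,
      trace_vecMulVec, dotProduct_comm] at this
  · rw [← hfS X (hsymm X hX)]
    exact (hu X hX).trans (huv.trans hv0)

theorem traceDefect_transpose (k : ℕ) {R : Matrix n n ℝ} (hR : Rᵀ = R) :
    (traceDefect k R)ᵀ = traceDefect k R := by simp [traceDefect, hR]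

/-- `R ↦ ∑ i, C iᵀ * traceDefect k (R i) * C i` as a linear map. -/
noncomputable def sumConjTraceDefect {ι : Type*} [Fintype ι] (k : ℕ) (C : ι → Matrix n n ℝ) :
    (ι → Matrix n n ℝ) →ₗ[ℝ] Matrix n n ℝ where
  toFun R := ∑ i, (C i)ᵀ * traceDefect k (R i) * C i
  map_add' R T := by
    rw [← Finset.sum_add_distrib]
    refine Finset.sum_congr rfl fun i _ => ?_
    rw [← add_mul, ← mul_add]
    simp only [traceDefect, Pi.add_apply, trace_add, add_div, add_smul]
    congr 2
    abel
  map_smul' c R := by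
    simp only [traceDefect, Pi.smul_apply, trace_smul, RingHom.id_apply, Finset.smul_sum,
      smul_eq_mul, mul_div_assoc, mul_smul, ← smul_sub, Matrix.mul_smul, Matrix.smul_mul]

/-- One positive semidefinite `S` that works for all the factors `C i` at once: testing with
`P = v vᵀ / |v|²` it says that every eigenvalue of `C i * S * (C i)ᵀ` is below `1 / k` of its
trace. -/
theorem exists_trace_conj_traceDefect_neg {ι : Type*} [Fintype ι] {k : ℕ} (hk : 0 < k)
    (hkn : k < Fintype.card n) (hι : Fintype.card ι * (k - 1) < Fintype.card n)
    (C : ι → Matrix n n ℝ) (hC : ∀ i, IsUnit (C i)) :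
    ∃ S : Matrix n n ℝ, S.PosSemidef ∧ ∀ i (P : Matrix n n ℝ), P.PosSemidef → P.trace = 1 →
      (S * ((C i)ᵀ * traceDefect k P * C i)).trace < 0 := by
  classical
  have hsymm : ∀ X ∈ sumConjTraceDefect k C '' densityTuples ι n, Xᵀ = X := by
    rintro _ ⟨R, ⟨hR, -⟩, rfl⟩
    have hRi : ∀ i, (traceDefect k (R i))ᵀ = traceDefect k (R i) := fun i =>
      traceDefect_transpose k (posSemidef_real_iff.1 (hR i)).1
    simp only [sumConjTraceDefect, LinearMap.coe_mk, AddHom.coe_mk, transpose_sum, transpose_mul,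
      transpose_transpose, hRi, mul_assoc]
  obtain ⟨S, hS, h⟩ := exists_posSemidef_trace_mul_neg
    (isCompact_densityTuples.image (LinearMap.continuous_of_finiteDimensional _))
    (convex_densityTuples.linear_image _) hsymm <| by
      rintro _ ⟨R, ⟨hR, ht⟩, rfl⟩
      exact not_posSemidef_sum_traceDefect hk hkn hι C hC R hR ht
  refine ⟨S, hS, fun i P hP hPt => ?_⟩
  -- the tuple with `P` in place `i` and zero elsewhere
  have hmem : Pi.single i P ∈ densityTuples ι n := by
    refine ⟨fun j => ?_, ?_⟩
    · rcases eq_or_ne j i with rfl | hj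
      · simpa using hP
      · simpa [Pi.single_eq_of_ne hj] using PosSemidef.zero
    · rw [Finset.sum_eq_single i (fun j _ hj => by simp [Pi.single_eq_of_ne hj]) (by simp)]
      simpa using hPt
  have := h _ ⟨_, hmem, rfl⟩
  rwa [sumConjTraceDefect, LinearMap.coe_mk, AddHom.coe_mk, Finset.sum_eq_single i
    (fun j _ hj => by simp [Pi.single_eq_of_ne hj, traceDefect]) (by simp),
    Pi.single_eq_same] at this

/-! ### From the separating matrix to the eigenvalue bound -/

theorem theorem1 (k d ℓ : ℕ) (hk : 0 < k) (hℓ : 0 < ℓ) (hkd : k < d)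
    (hbound : 1 < k → ℓ ≤ (d - 1) / (k - 1))
    (M : Fin ℓ → Matrix (Fin d) (Fin d) ℝ) (hM : ∀ i, (M i).PosDef) :
    ∃ A : Matrix (Fin d) (Fin d) ℝ, ∀ i : Fin ℓ,
      0 < Matrix.trace (A.transpose * M i * A) ∧
        lambdaOne (A.transpose * M i * A) / Matrix.trace (A.transpose * M i * A)
          < 1 / (k : ℝ) := by
  have hk' : (0 : ℝ) < k := by exact_mod_cast hk
  have hcount : Fintype.card (Fin ℓ) * (k - 1) < Fintype.card (Fin d) := by
    simp only [Fintype.card_fin]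
    rcases Nat.lt_or_ge 1 k with h | h
    · have := (Nat.le_div_iff_mul_le (by omega)).1 (hbound h)
      omega
    · rw [Nat.sub_eq_zero_of_le h]
      omega
  choose C hC using fun i => (hM i).posSemidef.exists_eq_transpose_mul
  have hCu : ∀ i, IsUnit (C i) := fun i =>
    isUnit_of_mul_isUnit_right (hC i ▸ (hM i).isUnit)
  obtain ⟨S, hS, hneg⟩ := exists_trace_conj_traceDefect_neg hk (by simpa using hkd) hcount C hCu
  obtain ⟨B, rfl⟩ := hS.exists_eq_transpose_mul
  refine ⟨Bᵀ, fun i => ?_⟩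
  obtain ⟨Y, hY⟩ : ∃ Y, Y = C i * Bᵀ := ⟨_, rfl⟩
  have hM' : Bᵀᵀ * M i * Bᵀ = Yᵀ * Y := by
    rw [hC i, hY, transpose_mul]
    simp only [mul_assoc]
  rw [hM']
  -- the separation inequality at the rank one density matrix `v vᵀ / |v|²`
  have hvec : ∀ v : Fin d → ℝ, v ≠ 0 →
      (Yᵀ *ᵥ v) ⬝ᵥ (Yᵀ *ᵥ v) < (Yᵀ * Y).trace / k * (v ⬝ᵥ v) := by
    intro v hv
    have hvv : 0 < v ⬝ᵥ v := by simpa using dotProduct_star_self_pos_iff.2 hv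
    have h := hneg i ((v ⬝ᵥ v)⁻¹ • vecMulVec v v)
      ((by simpa using posSemidef_vecMulVec_self_star v : (vecMulVec v v).PosSemidef).smul
        (inv_nonneg.2 hvv.le))
      (by simp [trace_vecMulVec, hvv.ne'])
    have hcyc : ∀ X : Matrix (Fin d) (Fin d) ℝ,
        (Bᵀ * B * ((C i)ᵀ * X * C i)).trace = (X * (Y * Yᵀ)).trace := fun X => by
      rw [hY, transpose_mul, transpose_transpose]
      calc _ = ((Bᵀ * B * (C i)ᵀ) * (X * C i)).trace := by simp only [mul_assoc]
        _ = _ := by rw [trace_mul_comm]; simp only [mul_assoc]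
    rw [hcyc, traceDefect, sub_mul, trace_sub, trace_smul, trace_vecMulVec, smul_mul, smul_mul,
      trace_smul, trace_smul, one_mul, vecMulVec_mul, trace_vecMulVec, trace_mul_comm Y,
      smul_eq_mul, smul_eq_mul, smul_eq_mul, inv_mul_cancel₀ hvv.ne'] at h
    have h2 : v ⬝ᵥ (v ᵥ* (Y * Yᵀ)) = (Yᵀ *ᵥ v) ⬝ᵥ (Yᵀ *ᵥ v) := by
      rw [← vecMul_vecMul, ← mulVec_transpose, ← mulVec_transpose Y, transpose_transpose,
        dotProduct_mulVec, ← mulVec_transpose]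
    rw [h2, sub_neg, inv_mul_lt_iff₀ hvv] at h
    rwa [mul_comm, one_div_mul_eq_div] at h
  have htr : 0 < (Yᵀ * Y).trace := by
    obtain ⟨v, hv⟩ : ∃ v : Fin d → ℝ, v ≠ 0 :=
      ⟨Pi.single ⟨0, by omega⟩ 1, by simp⟩
    have h0 : 0 ≤ (Yᵀ *ᵥ v) ⬝ᵥ (Yᵀ *ᵥ v) := by simpa using dotProduct_star_self_nonneg (Yᵀ *ᵥ v)
    have hvv : 0 < v ⬝ᵥ v := by simpa using dotProduct_star_self_pos_iff.2 hv
    have := pos_of_mul_pos_left (h0.trans_lt (hvec v hv)) hvv.le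
    exact (div_pos_iff_of_pos_right hk').1 this
  refine ⟨htr, ?_⟩
  have hherm : (Yᵀ * Y).IsHermitian := by simpa using isHermitian_conjTranspose_mul_self Y
  have hd : 0 < Fintype.card (Fin d) := by simpa using hk.trans hkd
  rw [div_lt_iff₀ htr, one_div_mul_eq_div]
  obtain ⟨u, hu⟩ := ((lambdaOne_eq_eigenvalues₀ hherm hd).symm ▸
    (isGreatest_eigenvalues₀ hherm hd).1 :
      Module.End.HasEigenvalue (toLin' (Yᵀ * Y)) (lambdaOne (Yᵀ * Y))).exists_hasEigenvector
  have hu' : (Yᵀ * Y) *ᵥ u = lambdaOne (Yᵀ * Y) • u := by simpa using hu.apply_eq_smul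
  rw [← mulVec_mulVec] at hu'
  -- a nonzero eigenvalue of `Yᵀ * Y` is carried over to `Y * Yᵀ` by the vector `Y *ᵥ u`
  by_cases hYu : Y *ᵥ u = 0
  · have : lambdaOne (Yᵀ * Y) = 0 := by
      rw [hYu, mulVec_zero] at hu'
      exact (smul_eq_zero.1 hu'.symm).resolve_right hu.2
    rw [this]
    exact div_pos htr hk'
  · have h := hvec _ hYu
    have hYY : 0 < (Y *ᵥ u) ⬝ᵥ (Y *ᵥ u) := by simpa using dotProduct_star_self_pos_iff.2 hYu
    have h3 : (Yᵀ *ᵥ (Y *ᵥ u)) ⬝ᵥ (Yᵀ *ᵥ (Y *ᵥ u))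
        = lambdaOne (Yᵀ * Y) * ((Y *ᵥ u) ⬝ᵥ (Y *ᵥ u)) := by
      conv_lhs => rw [mulVec_transpose, ← dotProduct_mulVec, ← mulVec_transpose, hu',
        mulVec_smul, dotProduct_smul, smul_eq_mul]
    rw [h3] at h
    exact lt_of_mul_lt_mul_right h hYY.le
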